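/- Let $\Bbbk$ be a field and let $\mathcal U(osp(1,2))$ (the dispin algebra) be the associative unital $\Bbbk$-algebra generated by $x,y,z$ subject to the relations $$yz-zy=z,\qquad zx+xz=y,\qquad xy-yx=x .$$ Then: (1) The standard monomials $x^iy^jz^l$ ($i,j,l\ge 0$) form a $\Bbbk$-basis of $\mathcal U(osp(1,2))$. Consequently $\mathcal U(osp(1,2))$ is a 3-dimensional skew polynomial algebra in $x,y,z$, that is, a $\Bbbk$-algebra generated by $x,y,z$ subject to relations $yz-\alpha zy=\lambda$, $zx-\beta xz=\mu$, $xy-\gamma yx=\nu$ with $\alpha,\beta,\gamma\in\Bbbk\setminus\{0\}$ and $\lambda,\mu,\nu\in\Bbbk+\Bbbk x+\Bbbk y+\Bbbk z$, in which the standard monomials $x^iy^jz^l$ ($i,j,l\ge0$) form a $\Bbbk$-basis. (2) Write $x_1=x$, $x_2=y$, $x_3=z$, and in the free algebra $\Bbbk\langle x_1,x_2,x_3\rangle$ let $Q$ be the reduction system consisting of the rules $x_2x_1\to f_{21}=x_1x_2-x_1$, $x_3x_1\to f_{31}=-x_1x_3+x_2$, $x_3x_2\to f_{32}=x_2x_3-x_3$.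 For a rule $W\to f$ and words $A,B$, the corresponding reduction is the $\Bbbk$-linear endomorphism of $\Bbbk\langle x_1,x_2,x_3\rangle$ that sends the word $AWB$ to $AfB$ and fixes all other words; a polynomial reduces to another if some finite sequence of reductions takes the first to the second; a standard polynomial is a $\Bbbk$-linear combination of words $x_1^ix_2^jx_3^l$. The two-sided ideal of $\Bbbk\langle x_1,x_2,x_3\rangle$ generated by the elements $W-f$, for the rules $W\to f$ of $Q$, is the ideal generated by the relations of the dispin algebra. The overlap $x_3x_2x_1$ reduces to the same standard polynomial both ways: $x_3f_{21}$ reduces under $Q$ to exactly one standard polynomial, $f_{32}x_1$ reduces under $Q$ to exactly one standard polynomial, and both are equal to $$-x_1x_2x_3+2x_1x_3+x_2^2-x_2 .$$ -/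

import Mathlib

/-! ### Reduction systems for the free algebra -/

/-- The word `w`, as an element of the free algebra `k⟨X⟩`. -/
noncomputable def freeWord (k : Type*) [CommRing k] {X : Type*} (w : FreeMonoid X) :
    FreeAlgebra k X :=
  FreeMonoid.lift (FreeAlgebra.ι k) w

open Classical in
/-- The reduction `r_{AσB}` for a rule `σ = (W, f)`: the `k`-linear endomorphism of `k⟨X⟩` that
sends the word `AWB` to `AfB` and fixes every other word. -/
noncomputable def reduction {k : Type*} [CommRing k] {X : Type*}
    (A : FreeMonoid X) (σ : FreeMonoid X × FreeAlgebra k X) (B : FreeMonoid X) :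
    FreeAlgebra k X →ₗ[k] FreeAlgebra k X :=
  (FreeAlgebra.basisFreeMonoid k X).constr k fun w =>
    if w = A * σ.1 * B then freeWord k A * σ.2 * freeWord k B else freeWord k w

/-- `f` reduces to `g` under the reduction system `Q`: some finite sequence of reductions for `Q`
takes `f` to `g`. -/
def ReducesTo {k : Type*} [CommRing k] {X : Type*} (Q : Set (FreeMonoid X × FreeAlgebra k X)) :
    FreeAlgebra k X → FreeAlgebra k X → Prop :=
  Relation.ReflTransGen fun f g => ∃ A B : FreeMonoid X, ∃ σ ∈ Q, g = reduction A σ B f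

/-- The two-sided ideal `I_Q` of `k⟨X⟩` generated by the elements `W - f`, `(W, f) ∈ Q`. -/
noncomputable def reductionIdeal {k : Type*} [CommRing k] {X : Type*}
    (Q : Set (FreeMonoid X × FreeAlgebra k X)) : TwoSidedIdeal (FreeAlgebra k X) :=
  TwoSidedIdeal.span {p | ∃ σ ∈ Q, p = freeWord k σ.1 - σ.2}

/-- The standard polynomials of `k⟨x₁, x₂, x₃⟩`: the linear combinations of the words
`x₁^i x₂^j x₃^l`. -/
noncomputable def standardPolynomials (k : Type*) [CommRing k] :
    Submodule k (FreeAlgebra k (Fin 3)) :=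
  Submodule.span k (Set.range fun p : ℕ × ℕ × ℕ =>
    FreeAlgebra.ι k 0 ^ p.1 * FreeAlgebra.ι k 1 ^ p.2.1 * FreeAlgebra.ι k 2 ^ p.2.2)

/-! ### Presentations and 3-dimensional skew polynomial algebras -/

/-- `A` is the `k`-algebra generated by the family `g` subject to the relations `r = 0`, `r ∈ R`:
the map `k⟨X⟩ → A` given by `g` is onto, and its kernel is the two-sided ideal generated by `R`. -/
def IsPresentedBy {k A : Type*} [CommRing k] [Ring A] [Algebra k A] {X : Type*}
    (g : X → A) (R : Set (FreeAlgebra k X)) : Prop :=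
  Function.Surjective (FreeAlgebra.lift k g) ∧
    TwoSidedIdeal.ker (FreeAlgebra.lift k g) = TwoSidedIdeal.span R

/-- The subspace `k + kx + ky + kz` of `k⟨x, y, z⟩`. -/
noncomputable def affineForms (k : Type*) [CommRing k] : Submodule k (FreeAlgebra k (Fin 3)) :=
  Submodule.span k {1, FreeAlgebra.ι k 0, FreeAlgebra.ι k 1, FreeAlgebra.ι k 2}

/-- The relations `yz - α zy = l`, `zx - β xz = m`, `xy - γ yx = n`. -/
noncomputable def skewRelations {k : Type*} [CommRing k] (α β γ : k)
    (l m n : FreeAlgebra k (Fin 3)) : Set (FreeAlgebra k (Fin 3)) :=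
  let x := FreeAlgebra.ι k (0 : Fin 3)
  let y := FreeAlgebra.ι k (1 : Fin 3)
  let z := FreeAlgebra.ι k (2 : Fin 3)
  {y * z - α • (z * y) - l, z * x - β • (x * z) - m, x * y - γ • (y * x) - n}

/-- The standard monomials `x^i y^j z^l` (`i, j, l ≥ 0`), indexed by `(i, j, l)`, are a `k`-basis
of `A`. -/
def StandardMonomialsFormBasis (k : Type*) {A : Type*} [CommRing k] [Ring A] [Algebra k A]
    (x y z : A) : Prop :=
  ∃ b : Module.Basis (ℕ × ℕ × ℕ) k A, ∀ i j l : ℕ, b (i, j, l) = x ^ i * y ^ j * z ^ l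

/-- `A` is a 3-dimensional skew polynomial algebra over `k` in the variables `x, y, z`. -/
def IsSkewPolynomialAlgebra₃ (k : Type*) {A : Type*} [Field k] [Ring A] [Algebra k A]
    (x y z : A) : Prop :=
  (∃ α β γ : k, α ≠ 0 ∧ β ≠ 0 ∧ γ ≠ 0 ∧
    ∃ l ∈ affineForms k, ∃ m ∈ affineForms k, ∃ n ∈ affineForms k,
      IsPresentedBy ![x, y, z] (skewRelations α β γ l m n)) ∧
  StandardMonomialsFormBasis k x y z

/-! ### The dispin algebra -/

namespace Dispin

/-- The relations `yz - zy = z`, `zx + xz = y`, `xy - yx = x` of the dispin algebra. -/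
noncomputable def relations (k : Type*) [Field k] : Set (FreeAlgebra k (Fin 3)) :=
  let x := FreeAlgebra.ι k (0 : Fin 3)
  let y := FreeAlgebra.ι k (1 : Fin 3)
  let z := FreeAlgebra.ι k (2 : Fin 3)
  {y * z - z * y - z, z * x + x * z - y, x * y - y * x - x}

/-- The dispin algebra `U(osp(1,2))`: the quotient of `k⟨x, y, z⟩` by the two-sided ideal
generated by its relations. -/
abbrev Alg (k : Type*) [Field k] : Type _ := (TwoSidedIdeal.span (relations k)).ringCon.Quotient

/-- The class in the dispin algebra of the `i`-th variable of `k⟨x, y, z⟩`. -/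
noncomputable def gen (k : Type*) [Field k] (i : Fin 3) : Alg k :=
  (TwoSidedIdeal.span (relations k)).ringCon.mk' (FreeAlgebra.ι k i)

variable (k : Type*) [Field k]

/-- The variable `x`. -/
noncomputable def x : Alg k := gen k 0

/-- The variable `y`. -/
noncomputable def y : Alg k := gen k 1

/-- The variable `z`. -/
noncomputable def z : Alg k := gen k 2

/-- The free variable `x₁ = x`. -/
noncomputable def x₁ : FreeAlgebra k (Fin 3) := FreeAlgebra.ι k 0

/-- The free variable `x₂ = y`. -/
noncomputable def x₂ : FreeAlgebra k (Fin 3) := FreeAlgebra.ι k 1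

/-- The free variable `x₃ = z`. -/
noncomputable def x₃ : FreeAlgebra k (Fin 3) := FreeAlgebra.ι k 2

/-- The right-hand side of the rule `x₂x₁ → x₁x₂ - x₁`. -/
noncomputable def f₂₁ : FreeAlgebra k (Fin 3) := x₁ k * x₂ k - x₁ k

/-- The right-hand side of the rule `x₃x₁ → -x₁x₃ + x₂`. -/
noncomputable def f₃₁ : FreeAlgebra k (Fin 3) := -(x₁ k * x₃ k) + x₂ k

/-- The right-hand side of the rule `x₃x₂ → x₂x₃ - x₃`. -/
noncomputable def f₃₂ : FreeAlgebra k (Fin 3) := x₂ k * x₃ k - x₃ k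

/-- The reduction system `{(x₂x₁, f₂₁), (x₃x₁, f₃₁), (x₃x₂, f₃₂)}` of the dispin algebra. -/
noncomputable def reductionSystem : Set (FreeMonoid (Fin 3) × FreeAlgebra k (Fin 3)) :=
  {(FreeMonoid.ofList [1, 0], f₂₁ k), (FreeMonoid.ofList [2, 0], f₃₁ k),
    (FreeMonoid.ofList [2, 1], f₃₂ k)}

end Dispin

/-! ### Words and reductions in a free algebra -/

section FreeAlgebra

variable {k : Type*} [CommRing k] {X : Type*}

/-! The standard monomials span because their span contains `1` and is stable under left
multiplication by `x`, `y` and `z`: the relations move a letter to the right past `x^i` and `y^j`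
(`stdSpan_eq_top`).

They are independent because left multiplication by the generators can be written down on a space
where independence is visible. Take `R = k[η, ζ]` and let `single i m` stand for `x^i m`, with `η^j
ζ^l` standing for `y^j z^l`. The relations dictate operators for `x`, `y`, `z`; these do satisfy the
relations, and the monomial `x^i y^j z^l` sends `single 0 1` to `single i (η^j ζ^l)`
(`action_stdWord`).

Reductions do not change the image in the quotient, and by independence the quotient map is
injective on standard polynomials. Hence a polynomial reduces to at most one of them
(`reducesTo_iff_eq`), and for the overlap it remains to exhibit one chain of reductions on each
side. -/

theorem basisFreeMonoid_apply (w : FreeMonoid X) :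
    FreeAlgebra.basisFreeMonoid k X w = freeWord k w := by
  simp [FreeAlgebra.basisFreeMonoid, freeWord, FreeAlgebra.equivMonoidAlgebraFreeMonoid,
    MonoidAlgebra.lift_single]

open Classical in
theorem reduction_freeWord (A : FreeMonoid X) (σ : FreeMonoid X × FreeAlgebra k X)
    (B w : FreeMonoid X) :
    reduction A σ B (freeWord k w) =
      if w = A * σ.1 * B then freeWord k A * σ.2 * freeWord k B else freeWord k w := by
  rw [reduction, ← basisFreeMonoid_apply w, Module.Basis.constr_basis, basisFreeMonoid_apply]

theorem reduction_freeWord_self (A : FreeMonoid X) (σ : FreeMonoid X × FreeAlgebra k X)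
    (B : FreeMonoid X) :
    reduction A σ B (freeWord k (A * σ.1 * B)) = freeWord k A * σ.2 * freeWord k B := by
  rw [reduction_freeWord, if_pos rfl]

theorem reduction_freeWord_of_ne (A : FreeMonoid X) (σ : FreeMonoid X × FreeAlgebra k X)
    (B : FreeMonoid X) {w : FreeMonoid X} (h : w ≠ A * σ.1 * B) :
    reduction A σ B (freeWord k w) = freeWord k w := by
  rw [reduction_freeWord, if_neg h]

/-- An algebra map that identifies the two sides of a rule is unchanged by its reductions. -/
theorem map_reduction {C : Type*} [Ring C] [Algebra k C] (φ : FreeAlgebra k X →ₐ[k] C)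
    (A : FreeMonoid X) (σ : FreeMonoid X × FreeAlgebra k X) (B : FreeMonoid X)
    (h : φ (freeWord k σ.1) = φ σ.2) (f : FreeAlgebra k X) :
    φ (reduction A σ B f) = φ f := by
  suffices φ.toLinearMap ∘ₗ reduction A σ B = φ.toLinearMap from LinearMap.congr_fun this f
  refine (FreeAlgebra.basisFreeMonoid k X).ext fun w => ?_
  simp only [LinearMap.comp_apply, AlgHom.toLinearMap_apply, basisFreeMonoid_apply]
  by_cases hw : w = A * σ.1 * B
  · subst hw
    rw [reduction_freeWord_self, map_mul, map_mul, ← h]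
    simp [freeWord]
  · rw [reduction_freeWord_of_ne _ _ _ hw]

theorem ReducesTo.map_eq {C : Type*} [Ring C] [Algebra k C] {φ : FreeAlgebra k X →ₐ[k] C}
    {Q : Set (FreeMonoid X × FreeAlgebra k X)} (hQ : ∀ σ ∈ Q, φ (freeWord k σ.1) = φ σ.2)
    {f g : FreeAlgebra k X} (h : ReducesTo Q f g) : φ g = φ f := by
  induction h with
  | refl => rfl
  | tail _ hstep ih =>
    obtain ⟨A, B, σ, hσ, rfl⟩ := hstep
    rw [map_reduction φ A σ B (hQ σ hσ), ih]

end FreeAlgebra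

namespace Dispin

/-! ### The dispin algebra as a quotient -/

section Quotient

variable (k : Type*) [Field k]

/-- The quotient map from the free algebra onto the dispin algebra. -/
noncomputable def proj : FreeAlgebra k (Fin 3) →ₐ[k] Alg k := RingCon.mkₐ k _

theorem proj_surjective : Function.Surjective (proj k) := RingCon.mkₐ_surjective _

theorem proj_ι (i : Fin 3) : proj k (FreeAlgebra.ι k i) = gen k i := rfl

theorem proj_eq_zero_iff (f : FreeAlgebra k (Fin 3)) :
    proj k f = 0 ↔ f ∈ TwoSidedIdeal.span (relations k) := by
  conv_rhs => rw [← TwoSidedIdeal.ker_ringCon_mk' (TwoSidedIdeal.span (relations k)),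
    TwoSidedIdeal.mem_ker]
  rfl

theorem proj_relation {f : FreeAlgebra k (Fin 3)} (hf : f ∈ relations k) : proj k f = 0 :=
  (proj_eq_zero_iff k f).2 (TwoSidedIdeal.subset_span hf)

theorem y_mul_x : y k * x k = x k * y k - x k := by
  have h : x k * y k - y k * x k - x k = 0 := proj_relation k (Or.inr (Or.inr rfl))
  rw [sub_sub, sub_eq_zero] at h
  rw [h, add_sub_cancel_right]

theorem z_mul_x : z k * x k = -(x k * z k) + y k := by
  have h : z k * x k + x k * z k - y k = 0 := proj_relation k (Or.inr (Or.inl rfl))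
  rw [sub_eq_zero] at h
  rw [← h]
  abel

theorem z_mul_y : z k * y k = y k * z k - z k := by
  have h : y k * z k - z k * y k - z k = 0 := proj_relation k (Or.inl rfl)
  rw [sub_sub, sub_eq_zero] at h
  rw [h, add_sub_cancel_right]

/-! ### The standard monomials span -/

/-- The standard monomial `x^i y^j z^l`. -/
noncomputable def stdMonomial (p : ℕ × ℕ × ℕ) : Alg k := x k ^ p.1 * y k ^ p.2.1 * z k ^ p.2.2

/-- The span of the standard monomials. -/
noncomputable abbrev stdSpan : Submodule k (Alg k) := Submodule.span k (Set.range (stdMonomial k))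

variable {k}

theorem monomial_mem (i j l : ℕ) : x k ^ i * (y k ^ j * z k ^ l) ∈ stdSpan k := by
  rw [← mul_assoc]
  exact Submodule.subset_span ⟨(i, j, l), rfl⟩

theorem mul_mem_of_monomials (a : Alg k)
    (h : ∀ i j l : ℕ, a * (x k ^ i * (y k ^ j * z k ^ l)) ∈ stdSpan k) :
    ∀ s ∈ stdSpan k, a * s ∈ stdSpan k := by
  intro s hs
  have : stdSpan k ≤ (stdSpan k).comap (LinearMap.mulLeft k a) := by
    refine Submodule.span_le.2 ?_
    rintro _ ⟨⟨i, j, l⟩, rfl⟩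
    simpa [stdMonomial, mul_assoc] using h i j l
  exact this hs

theorem x_mul_mem : ∀ s ∈ stdSpan k, x k * s ∈ stdSpan k := by
  refine mul_mem_of_monomials _ fun i j l => ?_
  rw [← mul_assoc, ← pow_succ']
  exact monomial_mem _ _ _

/-- Induction on the exponent of `x`, using `yx = x(y - 1)`. -/
theorem y_mul_mem : ∀ s ∈ stdSpan k, y k * s ∈ stdSpan k := by
  refine mul_mem_of_monomials _ fun i j l => ?_
  induction i with
  | zero =>
    simpa [pow_succ', mul_assoc] using monomial_mem (k := k) 0 (j + 1) l
  | succ i ih =>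
    have : y k * (x k ^ (i + 1) * (y k ^ j * z k ^ l)) =
        x k * (y k * (x k ^ i * (y k ^ j * z k ^ l))) - x k ^ (i + 1) * (y k ^ j * z k ^ l) := by
      rw [pow_succ', mul_assoc (x k), ← mul_assoc (y k), y_mul_x]
      noncomm_ring
    rw [this]
    exact sub_mem (x_mul_mem _ ih) (monomial_mem _ _ _)

/-- Each use of `zx = -xz + y` or `zy = yz - z` lowers an exponent to the right of `z` and leaves
outer factors `x` or `y`, whose stability is already known. -/
theorem z_mul_mem : ∀ s ∈ stdSpan k, z k * s ∈ stdSpan k := by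
  refine mul_mem_of_monomials _ fun i j l => ?_
  induction i with
  | zero =>
    simp only [pow_zero, one_mul]
    induction j with
    | zero => simpa [pow_succ'] using monomial_mem (k := k) 0 0 (l + 1)
    | succ j ih =>
      have : z k * (y k ^ (j + 1) * z k ^ l) =
          y k * (z k * (y k ^ j * z k ^ l)) - z k * (y k ^ j * z k ^ l) := by
        rw [pow_succ', mul_assoc (y k), ← mul_assoc (z k), z_mul_y]
        noncomm_ring
      rw [this]
      exact sub_mem (y_mul_mem _ ih) ih
  | succ i ih =>
    have : z k * (x k ^ (i + 1) * (y k ^ j * z k ^ l)) =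
        y k * (x k ^ i * (y k ^ j * z k ^ l)) - x k * (z k * (x k ^ i * (y k ^ j * z k ^ l))) := by
      rw [pow_succ', mul_assoc (x k), ← mul_assoc (z k), z_mul_x]
      noncomm_ring
    rw [this]
    exact sub_mem (y_mul_mem _ (monomial_mem _ _ _)) (x_mul_mem _ ih)

theorem proj_mul_mem (a : FreeAlgebra k (Fin 3)) :
    ∀ s ∈ stdSpan k, proj k a * s ∈ stdSpan k := by
  induction a with
  | grade0 r =>
    intro s hs
    rw [AlgHom.commutes, ← Algebra.smul_def]
    exact Submodule.smul_mem _ _ hs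
  | grade1 i =>
    rw [proj_ι]
    fin_cases i
    · exact x_mul_mem
    · exact y_mul_mem
    · exact z_mul_mem
  | mul a b ha hb =>
    intro s hs
    rw [map_mul, mul_assoc]
    exact ha _ (hb _ hs)
  | add a b ha hb =>
    intro s hs
    rw [map_add, add_mul]
    exact add_mem (ha _ hs) (hb _ hs)

theorem stdSpan_eq_top : stdSpan k = ⊤ := by
  refine eq_top_iff.2 fun a _ => ?_
  obtain ⟨f, rfl⟩ := proj_surjective k a
  simpa using proj_mul_mem f 1 (by simpa using monomial_mem (k := k) 0 0 0)

end Quotient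

/-! ### The standard monomials are linearly independent -/

section Action

variable {k : Type*} [Field k] {R : Type*} [CommRing R] [Algebra k R]

/-- The elements `p_i` with `z x^i = (-1)^i x^i z + x^(i-1) p_i`. -/
def correction (η : R) : ℕ → R
  | 0 => 0
  | i + 1 => η - i - correction η i

variable (k R) in
/-- The action of `x` on `ℕ →₀ R`, where `single i m` stands for `x^i m`. -/
noncomputable def actX : Module.End k (ℕ →₀ R) := Finsupp.lmapDomain _ k (· + 1)

variable (k) in
/-- The action of `y` on `ℕ →₀ R`, if it acts on `R` as multiplication by `η`. -/
noncomputable def actY (η : R) : Module.End k (ℕ →₀ R) :=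
  Finsupp.lsum k fun i => Finsupp.lsingle i ∘ₗ LinearMap.mulLeft k (η - i)

/-- The action of `z` on `ℕ →₀ R`, if it acts on `R` as `m ↦ ζ * τ m`. -/
noncomputable def actZ (η ζ : R) (τ : R →ₐ[k] R) : Module.End k (ℕ →₀ R) :=
  Finsupp.lsum k fun i =>
    Finsupp.lsingle i ∘ₗ LinearMap.mulLeft k ((-1) ^ i * ζ) ∘ₗ τ.toLinearMap +
    Finsupp.lsingle (i - 1) ∘ₗ LinearMap.mulLeft k (correction η i)

variable (η ζ : R) (τ : R →ₐ[k] R)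

theorem actX_single (i : ℕ) (m : R) :
    actX k R (Finsupp.single i m) = Finsupp.single (i + 1) m := by
  simp [actX]

theorem actY_single (i : ℕ) (m : R) :
    actY k η (Finsupp.single i m) = Finsupp.single i ((η - i) * m) := by
  simp [actY, -Finsupp.single_mul]

theorem actZ_single (i : ℕ) (m : R) :
    actZ η ζ τ (Finsupp.single i m) =
      Finsupp.single i ((-1) ^ i * ζ * τ m) + Finsupp.single (i - 1) (correction η i * m) := by
  simp [actZ, mul_assoc, -Finsupp.single_mul]

theorem actX_actY : actX k R * actY k η - actY k η * actX k R = actX k R := by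
  refine Finsupp.lhom_ext fun i m => ?_
  simp only [LinearMap.sub_apply, Module.End.mul_apply, actX_single, actY_single,
    ← Finsupp.single_sub]
  congr 1
  push_cast
  ring

/-- The recursion of `correction` is exactly what this relation demands: `p_(i+1) + p_i = η - i`. -/
theorem actZ_actX : actZ η ζ τ * actX k R + actX k R * actZ η ζ τ = actY k η := by
  refine Finsupp.lhom_ext fun i m => ?_
  simp only [LinearMap.add_apply, Module.End.mul_apply, actX_single, actY_single, actZ_single,
    map_add, Nat.add_sub_cancel]
  -- The truncated index `i - 1` at `i = 0` is harmless, since `correction η 0 = 0`.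
  cases i with
  | zero =>
    rw [add_right_comm, ← Finsupp.single_add]
    simp [correction, -Finsupp.single_mul]
  | succ i =>
    rw [Nat.add_sub_cancel, add_add_add_comm, ← Finsupp.single_add, ← Finsupp.single_add]
    have h : (-1) ^ (i + 1 + 1) * ζ * τ m + (-1) ^ (i + 1) * ζ * τ m = 0 := by ring
    rw [h, Finsupp.single_zero, zero_add, ← add_mul]
    simp [correction, -Finsupp.single_mul]

variable {η τ} in
-- The twist encodes `zy = (y - 1)z`: moving `z` past a polynomial in `y` shifts `y` by one, hence
-- the hypothesis on `τ η`.
theorem actY_actZ (hη : τ η = η - 1) :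
    actY k η * actZ η ζ τ - actZ η ζ τ * actY k η = actZ η ζ τ := by
  refine Finsupp.lhom_ext fun i m => ?_
  simp only [LinearMap.sub_apply, Module.End.mul_apply, actY_single, actZ_single, map_add,
    map_mul, map_sub, map_natCast, hη]
  rw [add_sub_add_comm, ← Finsupp.single_sub]
  congr 1
  · congr 1
    ring
  · cases i with
    | zero => simp [correction]
    | succ i =>
      rw [Nat.add_sub_cancel, ← Finsupp.single_sub]
      congr 1
      push_cast
      ring

/-- The action of the free algebra on `ℕ →₀ R`. -/
noncomputable def action : FreeAlgebra k (Fin 3) →ₐ[k] Module.End k (ℕ →₀ R) :=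
  FreeAlgebra.lift k ![actX k R, actY k η, actZ η ζ τ]

theorem action_ι_zero : action η ζ τ (FreeAlgebra.ι k 0) = actX k R := by simp [action]

theorem action_ι_one : action η ζ τ (FreeAlgebra.ι k 1) = actY k η := by simp [action]

theorem action_ι_two : action η ζ τ (FreeAlgebra.ι k 2) = actZ η ζ τ := by simp [action]

variable {η τ} in
theorem action_eq_zero (hη : τ η = η - 1) {f : FreeAlgebra k (Fin 3)}
    (hf : f ∈ TwoSidedIdeal.span (relations k)) : action η ζ τ f = 0 := by
  rw [← TwoSidedIdeal.mem_ker]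
  refine TwoSidedIdeal.span_le.2 ?_ hf
  rintro g (rfl | rfl | rfl) <;> rw [SetLike.mem_coe, TwoSidedIdeal.mem_ker] <;>
    simp only [map_sub, map_add, map_mul, action_ι_zero, action_ι_one, action_ι_two]
  · rw [actY_actZ ζ hη, sub_self]
  · rw [actZ_actX, sub_self]
  · rw [actX_actY, sub_self]

variable (k) in
/-- The standard word `x₁^i x₂^j x₃^l` in the free algebra. -/
noncomputable def stdWord (p : ℕ × ℕ × ℕ) : FreeAlgebra k (Fin 3) :=
  FreeAlgebra.ι k 0 ^ p.1 * FreeAlgebra.ι k 1 ^ p.2.1 * FreeAlgebra.ι k 2 ^ p.2.2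

variable {ζ τ} in
theorem actZ_pow_single (hζ : τ ζ = ζ) (l : ℕ) :
    (actZ η ζ τ ^ l) (Finsupp.single 0 1) = Finsupp.single 0 (ζ ^ l) := by
  induction l with
  | zero => simp
  | succ l ih =>
    rw [pow_succ', Module.End.mul_apply, ih, actZ_single]
    simp [correction, hζ, pow_succ', -Finsupp.single_mul]

theorem actY_pow_single (j : ℕ) (m : R) :
    (actY k η ^ j) (Finsupp.single 0 m) = Finsupp.single 0 (η ^ j * m) := by
  induction j with
  | zero => simp
  | succ j ih =>
    rw [pow_succ', Module.End.mul_apply, ih, actY_single]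
    simp [pow_succ', mul_assoc, -Finsupp.single_mul]

theorem actX_pow_single (i : ℕ) (m : R) :
    (actX k R ^ i) (Finsupp.single 0 m) = Finsupp.single i m := by
  induction i with
  | zero => simp
  | succ i ih => rw [pow_succ', Module.End.mul_apply, ih, actX_single]

variable {ζ τ} in
theorem action_stdWord (hζ : τ ζ = ζ) (p : ℕ × ℕ × ℕ) :
    action η ζ τ (stdWord k p) (Finsupp.single 0 1) =
      Finsupp.single p.1 (η ^ p.2.1 * ζ ^ p.2.2) := by
  simp only [stdWord, map_mul, map_pow, action_ι_zero, action_ι_one, action_ι_two,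
    Module.End.mul_apply]
  rw [actZ_pow_single η hζ, actY_pow_single, actX_pow_single]

theorem proj_stdWord (p : ℕ × ℕ × ℕ) : proj k (stdWord k p) = stdMonomial k p := by
  simp only [stdWord, stdMonomial, map_mul, map_pow, proj_ι]
  rfl

variable {η ζ τ} in
theorem linearIndependent_stdMonomial_of_twist (hη : τ η = η - 1) (hζ : τ ζ = ζ)
    (hind : LinearIndependent k fun q : ℕ × ℕ => η ^ q.1 * ζ ^ q.2) :
    LinearIndependent k (stdMonomial k) := by
  have hsingle : LinearIndependent k fun p : ℕ × ℕ × ℕ =>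
      (Finsupp.single p.1 (η ^ p.2.1 * ζ ^ p.2.2) : ℕ →₀ R) :=
    (Finsupp.linearIndependent_single (fun _ : ℕ => fun q : ℕ × ℕ => η ^ q.1 * ζ ^ q.2)
      fun _ => hind).comp (fun p : ℕ × ℕ × ℕ => ⟨p.1, p.2⟩) (Equiv.sigmaEquivProd _ _).symm.injective
  rw [linearIndependent_iff]
  intro c hc
  refine linearIndependent_iff.1 hsingle c ?_
  have h₁ : proj k (Finsupp.linearCombination k (stdWord k) c) = 0 := by
    rw [← hc]
    simp only [Finsupp.linearCombination_apply, Finsupp.sum, map_sum, map_smul, proj_stdWord]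
  -- A relation between monomials in the quotient acts as zero; evaluating at `single 0 1` turns it
  -- into a relation between the vectors of `hsingle`.
  have h₂ := LinearMap.congr_fun (action_eq_zero ζ hη ((proj_eq_zero_iff k _).1 h₁))
    (Finsupp.single 0 1)
  simpa only [Finsupp.linearCombination_apply, Finsupp.sum, map_sum, map_smul,
    LinearMap.sum_apply, LinearMap.smul_apply, LinearMap.zero_apply, action_stdWord η hζ] using h₂

end Action

/-! ### The coefficient ring `k[η, ζ]` -/

section Polynomial

open Polynomial

variable {k : Type*} [Field k]

theorem linearIndependent_C_X_pow_mul_X_pow :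
    LinearIndependent k fun q : ℕ × ℕ => (C X : k[X][X]) ^ q.1 * X ^ q.2 := by
  refine LinearIndependent.of_pairwise_dual_eq_zero_one _
    -- The dual family extracts the coefficient of `η^j ζ^l`, with `η` the inner and `ζ` the outer
    -- variable.
    (fun q => lcoeff k q.1 ∘ₗ (lcoeff k[X] q.2).restrictScalars k) ?_ ?_
  · rintro ⟨j, l⟩ ⟨j', l'⟩ h
    simp only [LinearMap.comp_apply, lcoeff_apply, LinearMap.restrictScalars_apply, ← C_pow,
      coeff_C_mul, coeff_X_pow]
    by_cases hl : l = l'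
    · subst hl
      have hj : j ≠ j' := by rintro rfl; exact h rfl
      simp [coeff_X_pow, hj]
    · simp [hl]
  · rintro ⟨j, l⟩
    simp [← C_pow, -map_pow]

theorem linearIndependent_stdMonomial : LinearIndependent k (stdMonomial k) :=
  -- This `τ` substitutes `η - 1` for `η` in each coefficient and fixes `ζ`.
  linearIndependent_stdMonomial_of_twist (τ := mapAlgHom (aeval (X - 1 : k[X])))
    (by simp) (by simp) linearIndependent_C_X_pow_mul_X_pow

end Polynomial

/-! ### The skew polynomial structure, the ideal of the rules and the overlap -/

section Main

variable (k : Type*) [Field k]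

theorem standardMonomialsFormBasis : StandardMonomialsFormBasis k (x k) (y k) (z k) :=
  ⟨Module.Basis.mk linearIndependent_stdMonomial (stdSpan_eq_top (k := k)).ge,
    fun i j l => by simp [stdMonomial]⟩

theorem lift_gen : FreeAlgebra.lift k ![x k, y k, z k] = proj k := by
  ext i
  fin_cases i <;> simp [proj_ι, x, y, z]

theorem skewRelations_eq :
    skewRelations (1 : k) (-1) 1 (FreeAlgebra.ι k 2) (FreeAlgebra.ι k 1) (FreeAlgebra.ι k 0) =
      relations k := by
  simp [skewRelations, relations]

theorem isSkewPolynomialAlgebra₃ : IsSkewPolynomialAlgebra₃ k (x k) (y k) (z k) := by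
  refine ⟨⟨1, -1, 1, one_ne_zero, neg_ne_zero.2 one_ne_zero, one_ne_zero,
    FreeAlgebra.ι k 2, Submodule.subset_span (by simp),
    FreeAlgebra.ι k 1, Submodule.subset_span (by simp),
    FreeAlgebra.ι k 0, Submodule.subset_span (by simp), ?_, ?_⟩, standardMonomialsFormBasis k⟩
  · rw [lift_gen]
    exact proj_surjective k
  · rw [lift_gen, skewRelations_eq]
    ext f
    rw [TwoSidedIdeal.mem_ker, proj_eq_zero_iff]

theorem freeWord_ofList (l : List (Fin 3)) :
    freeWord k (FreeMonoid.ofList l) = (l.map (FreeAlgebra.ι k)).prod := by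
  simp [freeWord, FreeMonoid.lift_apply]

/-- The two sets of generators agree up to sign: the rules for `x₂x₁` and `x₃x₂` give the negatives
of the corresponding relations. -/
theorem reductionIdeal_eq :
    reductionIdeal (reductionSystem k) = TwoSidedIdeal.span (relations k) := by
  refine le_antisymm (TwoSidedIdeal.span_le.2 ?_) (TwoSidedIdeal.span_le.2 ?_)
  · rintro _ ⟨σ, (rfl | rfl | rfl), rfl⟩
    · rw [SetLike.mem_coe, ← neg_mem_iff]
      refine TwoSidedIdeal.subset_span (Or.inr (Or.inr ?_))
      simp only [freeWord_ofList]
      simp [f₂₁, x₁, x₂]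
      abel
    · refine TwoSidedIdeal.subset_span (Or.inr (Or.inl ?_))
      simp only [freeWord_ofList]
      simp [f₃₁, x₁, x₂, x₃]
      abel
    · rw [SetLike.mem_coe, ← neg_mem_iff]
      refine TwoSidedIdeal.subset_span (Or.inl ?_)
      simp only [freeWord_ofList]
      simp [f₃₂, x₂, x₃]
      abel
  · rintro _ (rfl | rfl | rfl)
    · rw [SetLike.mem_coe, ← neg_mem_iff]
      refine TwoSidedIdeal.subset_span ⟨_, Or.inr (Or.inr rfl), ?_⟩
      simp only [freeWord_ofList]
      simp [f₃₂, x₂, x₃]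
      abel
    · refine TwoSidedIdeal.subset_span ⟨_, Or.inr (Or.inl rfl), ?_⟩
      simp only [freeWord_ofList]
      simp [f₃₁, x₁, x₂, x₃]
      abel
    · rw [SetLike.mem_coe, ← neg_mem_iff]
      refine TwoSidedIdeal.subset_span ⟨_, Or.inl rfl, ?_⟩
      simp only [freeWord_ofList]
      simp [f₂₁, x₁, x₂]
      abel

variable {k}

theorem proj_rule {σ : FreeMonoid (Fin 3) × FreeAlgebra k (Fin 3)} (hσ : σ ∈ reductionSystem k) :
    proj k (freeWord k σ.1) = proj k σ.2 := by
  rw [← sub_eq_zero, ← map_sub, proj_eq_zero_iff, ← reductionIdeal_eq]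
  exact TwoSidedIdeal.subset_span ⟨σ, hσ, rfl⟩

/-- Standard polynomials map to combinations of standard monomials, which are independent in the
quotient. -/
theorem proj_injOn : Set.InjOn (proj k) (standardPolynomials k) := by
  intro f hf g hg h
  obtain ⟨c, rfl⟩ := Finsupp.mem_span_range_iff_exists_finsupp.1 hf
  obtain ⟨d, rfl⟩ := Finsupp.mem_span_range_iff_exists_finsupp.1 hg
  have hcomb (c : ℕ × ℕ × ℕ →₀ k) : proj k (c.sum fun p a => a • stdWord k p) =
      Finsupp.linearCombination k (stdMonomial k) c := by
    simp [Finsupp.linearCombination_apply, Finsupp.sum, proj_stdWord]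
  have hcd : c = d := linearIndependent_stdMonomial ((hcomb c).symm.trans (h.trans (hcomb d)))
  rw [hcd]

/-- A polynomial reduces to at most one standard polynomial. -/
theorem reducesTo_iff_eq {f g : FreeAlgebra k (Fin 3)} (hg : g ∈ standardPolynomials k)
    (hfg : ReducesTo (reductionSystem k) f g) {h : FreeAlgebra k (Fin 3)}
    (hh : h ∈ standardPolynomials k) : ReducesTo (reductionSystem k) f h ↔ h = g := by
  refine ⟨fun hfh => proj_injOn hh hg ?_, fun e => e ▸ hfg⟩
  rw [hfh.map_eq fun _ => proj_rule, hfg.map_eq fun _ => proj_rule]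

variable (k) in
/-- The word with the given letters, as an element of the free algebra. -/
noncomputable def word (l : List (Fin 3)) : FreeAlgebra k (Fin 3) :=
  freeWord k (FreeMonoid.ofList l)

theorem word_eq (l : List (Fin 3)) : word k l = (l.map (FreeAlgebra.ι k)).prod :=
  freeWord_ofList k l

theorem reduction_word (a b l : List (Fin 3)) (w : List (Fin 3)) (f : FreeAlgebra k (Fin 3)) :
    reduction (FreeMonoid.ofList a) (FreeMonoid.ofList w, f) (FreeMonoid.ofList b) (word k l) =
      if l = a ++ w ++ b then word k a * f * word k b else word k l := by
  by_cases h : l = a ++ w ++ b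
  · rw [if_pos h]
    subst h
    exact reduction_freeWord_self _ (FreeMonoid.ofList w, f) _
  · rw [if_neg h]
    exact reduction_freeWord_of_ne _ (FreeMonoid.ofList w, f) _ h

theorem reducesTo_step {f g : FreeAlgebra k (Fin 3)} (a b : List (Fin 3))
    {w : List (Fin 3)} {r : FreeAlgebra k (Fin 3)}
    (hr : (FreeMonoid.ofList w, r) ∈ reductionSystem k)
    (h : reduction (FreeMonoid.ofList a) (FreeMonoid.ofList w, r) (FreeMonoid.ofList b) f = g) :
    ReducesTo (reductionSystem k) f g :=
  Relation.ReflTransGen.single ⟨_, _, _, hr, h.symm⟩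

variable (k) in
/-- The common standard form of the two reductions of the overlap `x₃x₂x₁`. -/
noncomputable def overlapForm : FreeAlgebra k (Fin 3) :=
  -word k [0, 1, 2] + (2 : k) • word k [0, 2] + word k [1, 1] - word k [1]

theorem overlapForm_eq : overlapForm k =
    -(x₁ k * x₂ k * x₃ k) + 2 * (x₁ k * x₃ k) + x₂ k ^ 2 - x₂ k := by
  simp [overlapForm, word_eq, x₁, x₂, x₃, two_smul, two_mul, sq, mul_assoc]

theorem overlapForm_mem : overlapForm k ∈ standardPolynomials k := by
  have h (i j l : ℕ) : stdWord k (i, j, l) ∈ standardPolynomials k :=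
    Submodule.subset_span ⟨(i, j, l), rfl⟩
  have h₁ := h 1 1 1
  have h₂ := h 1 0 1
  have h₃ := h 0 2 0
  have h₄ := h 0 1 0
  simp only [stdWord, pow_zero, pow_one, one_mul, mul_one, mul_assoc, sq] at h₁ h₂ h₃ h₄
  simp only [overlapForm, word_eq, List.map_cons, List.map_nil, List.prod_cons, List.prod_nil,
    mul_one]
  exact sub_mem (add_mem (add_mem (neg_mem h₁) (Submodule.smul_mem _ _ h₂)) h₃) h₄

theorem mem_rule₂₁ : (FreeMonoid.ofList [1, 0], f₂₁ k) ∈ reductionSystem k := Or.inl rfl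

theorem mem_rule₃₁ : (FreeMonoid.ofList [2, 0], f₃₁ k) ∈ reductionSystem k := Or.inr (Or.inl rfl)

theorem mem_rule₃₂ : (FreeMonoid.ofList [2, 1], f₃₂ k) ∈ reductionSystem k := Or.inr (Or.inr rfl)

theorem reducesTo_x₃_mul_f₂₁ : ReducesTo (reductionSystem k) (x₃ k * f₂₁ k) (overlapForm k) := by
  have h₀ : x₃ k * f₂₁ k = word k [2, 0, 1] - word k [2, 0] := by
    simp [word_eq, f₂₁, x₁, x₂, x₃, mul_sub]
  have h₁ : ReducesTo (reductionSystem k) (word k [2, 0, 1] - word k [2, 0])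
      (-word k [0, 2, 1] + word k [1, 1] - word k [2, 0]) := by
    -- A reduction rewrites one word only, so `x₃x₁x₂` and `x₃x₁` need separate steps although the
    -- rule is the same.
    refine reducesTo_step [] [1] mem_rule₃₁ ?_
    simp only [map_sub, reduction_word]
    simp [word_eq, f₃₁, x₁, x₂, x₃, add_mul, mul_assoc]
  have h₂ : ReducesTo (reductionSystem k) (-word k [0, 2, 1] + word k [1, 1] - word k [2, 0])
      (-word k [0, 2, 1] + word k [1, 1] + word k [0, 2] - word k [1]) := by
    refine reducesTo_step [] [] mem_rule₃₁ ?_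
    simp only [map_sub, map_add, map_neg, reduction_word]
    simp [word_eq, f₃₁, x₁, x₂, x₃]
    abel
  have h₃ : ReducesTo (reductionSystem k)
      (-word k [0, 2, 1] + word k [1, 1] + word k [0, 2] - word k [1]) (overlapForm k) := by
    refine reducesTo_step [0] [] mem_rule₃₂ ?_
    simp only [map_sub, map_add, map_neg, reduction_word, overlapForm]
    simp [word_eq, f₃₂, x₂, x₃, mul_sub, two_smul]
    abel
  rw [h₀]
  exact (h₁.trans h₂).trans h₃

theorem reducesTo_f₃₂_mul_x₁ : ReducesTo (reductionSystem k) (f₃₂ k * x₁ k) (overlapForm k) := by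
  have h₀ : f₃₂ k * x₁ k = word k [1, 2, 0] - word k [2, 0] := by
    simp [word_eq, f₃₂, x₁, x₂, x₃, sub_mul, mul_assoc]
  have h₁ : ReducesTo (reductionSystem k) (word k [1, 2, 0] - word k [2, 0])
      (-word k [1, 0, 2] + word k [1, 1] - word k [2, 0]) := by
    refine reducesTo_step [1] [] mem_rule₃₁ ?_
    simp only [map_sub, reduction_word]
    simp [word_eq, f₃₁, x₁, x₂, x₃, mul_add]
  have h₂ : ReducesTo (reductionSystem k) (-word k [1, 0, 2] + word k [1, 1] - word k [2, 0])
      (-word k [1, 0, 2] + word k [1, 1] + word k [0, 2] - word k [1]) := by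
    refine reducesTo_step [] [] mem_rule₃₁ ?_
    simp only [map_sub, map_add, map_neg, reduction_word]
    simp [word_eq, f₃₁, x₁, x₂, x₃]
    abel
  have h₃ : ReducesTo (reductionSystem k)
      (-word k [1, 0, 2] + word k [1, 1] + word k [0, 2] - word k [1]) (overlapForm k) := by
    refine reducesTo_step [] [2] mem_rule₂₁ ?_
    simp only [map_sub, map_add, map_neg, reduction_word, overlapForm]
    simp [word_eq, f₂₁, x₁, x₂, sub_mul, mul_assoc, two_smul]
    abel
  rw [h₀]
  exact (h₁.trans h₂).trans h₃

end Main

end Dispin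

theorem mainTheorem3 (k : Type*) [Field k] :
    StandardMonomialsFormBasis k (Dispin.x k) (Dispin.y k) (Dispin.z k) ∧
    IsSkewPolynomialAlgebra₃ k (Dispin.x k) (Dispin.y k) (Dispin.z k) ∧
    reductionIdeal (Dispin.reductionSystem k) = TwoSidedIdeal.span (Dispin.relations k) ∧
    ∃ g ∈ standardPolynomials k,
      g = -(Dispin.x₁ k * Dispin.x₂ k * Dispin.x₃ k) + 2 * (Dispin.x₁ k * Dispin.x₃ k)
        + Dispin.x₂ k ^ 2 - Dispin.x₂ k ∧
      (∀ h ∈ standardPolynomials k,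
        ReducesTo (Dispin.reductionSystem k) (Dispin.x₃ k * Dispin.f₂₁ k) h ↔ h = g) ∧
      (∀ h ∈ standardPolynomials k,
        ReducesTo (Dispin.reductionSystem k) (Dispin.f₃₂ k * Dispin.x₁ k) h ↔ h = g) :=
  ⟨Dispin.standardMonomialsFormBasis k, Dispin.isSkewPolynomialAlgebra₃ k,
    Dispin.reductionIdeal_eq k, Dispin.overlapForm k, Dispin.overlapForm_mem,
    Dispin.overlapForm_eq,
    fun _ => Dispin.reducesTo_iff_eq Dispin.overlapForm_mem Dispin.reducesTo_x₃_mul_f₂₁,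
    fun _ => Dispin.reducesTo_iff_eq Dispin.overlapForm_mem Dispin.reducesTo_f₃₂_mul_x₁⟩
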